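/- Let $\Omega\subset\mathbb R^d$ be compact with a (Borel) probability measure $\mu$. For a continuous function $f$ on $\Omega$, real- or complex-valued, put $\|f\|_q=\left(\int_\Omega|f|^q\,d\mu\right)^{1/q}$ and $\|f\|_\infty=\max_{x\in\Omega}|f(x)|$. For a nonempty set $A$ of continuous functions on $\Omega$ and an integer $k\ge 0$, let $e_k(A,L_\infty)\in[0,\infty]$ be the infimum of all $\varepsilon>0$ for which there are $f_1,\dots,f_{N_k}\in A$ (not necessarily distinct) such that every $f\in A$ satisfies $\|f-f_j\|_\infty<\varepsilon$ for some $j$; here $N_0=1$ and $N_k=2^{2^k}$ for $k\ge1$. There is a universal constant $c>0$ such that the following holds. Let $N\ge 1$, let $X_N$ be an $N$-dimensional linear subspace (over the field of values) of the space of continuous functions on $\Omega$, let $q\in(2,\infty)$, $B>0$, put $X_N^q=\{f\in X_N:\|f\|_q\le 1\}$, and assume that for all integers $k\ge0$ $$ e_k(X_N^q,L_\infty)\le B\begin{cases}(N/2^k)^{1/q}, & k\le\log_2 N,\\ 2^{-2^k/N}, & k>\log_2 N.\end{cases} $$ Then for every integer $$ m\ge c\,q^2B^qN^{1-2/q}\max\left\{\left(\frac{N^{1/2}-N^{1/q}}{1/2-1/q}\right)^2,\;N\right\}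 $$ there are $m$ points $\xi^1,\dots,\xi^m\in\Omega$ (not necessarily distinct) such that $$ \frac12\|f\|_q^q\le\frac1m\sum_{j=1}^m|f(\xi^j)|^q\le\frac32\|f\|_q^q\qquad\text{for all } f\in X_N . $$ -/

import Mathlib

open MeasureTheory
open scoped ENNReal NNReal

noncomputable section

/-- The sequence `N_0 = 1`, `N_n = 2 ^ (2 ^ n)` for `n ≥ 1`. -/
def coverSize (n : ℕ) : ℕ := if n = 0 then 1 else 2 ^ (2 ^ n)

/-- The entropy number `e_n(A)` of a nonempty subset `A` of a metric space: the infimum of the radii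
`ε` for which there are `N_n` centres in `A` (not necessarily distinct) whose open `ε`-balls
cover `A`. It takes values in `[0, ∞]`, and is `∞` when there is no such `ε`. -/
def entropyNumber {F : Type*} [PseudoMetricSpace F] (A : Set F) (n : ℕ) : ℝ≥0∞ :=
  ⨅ (ε : ℝ≥0) (_ : ∃ f : Fin (coverSize n) → F,
    (∀ j, f j ∈ A) ∧ A ⊆ ⋃ j, Metric.ball (f j) (ε : ℝ)), (ε : ℝ≥0∞)

/-- The norm `‖f‖_q = (∫ |f|^q dμ)^{1/q}` of a continuous function. -/
def lqNorm {Ω 𝕜 : Type*} [TopologicalSpace Ω] [MeasurableSpace Ω] [RCLike 𝕜]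
    (μ : Measure Ω) (q : ℝ) (f : C(Ω, 𝕜)) : ℝ :=
  (∫ x, ‖f x‖ ^ q ∂μ) ^ (1 / q)

/-- The unit `L_q`-ball `{f ∈ X : ‖f‖_q ≤ 1}` of a subspace `X`, as a subset of the space of
continuous functions (whose metric, for compact `Ω`, is the one of the uniform norm). -/
def lqUnitBall {Ω 𝕜 : Type*} [TopologicalSpace Ω] [MeasurableSpace Ω] [RCLike 𝕜]
    (μ : Measure Ω) (q : ℝ) (X : Submodule 𝕜 C(Ω, 𝕜)) : Set C(Ω, 𝕜) :=
  {f | f ∈ X ∧ lqNorm μ q f ≤ 1}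

end

/-! Draw the `m` points independently from `μ`, and let `Y` be the largest deviation, over a fine
finite net of the unit ball, of `∑ |f(x_j)|^q` from its mean. Symmetrization
(`integral_norm_sum_sub_integral_le`) bounds `E Y` by twice a Rademacher average. With the points
fixed, Dudley chaining (`signAvg_norm_chain_le`) bounds that average.

The decisive point is that the chaining bound is self-improving. By `sq_rpow_sub_rpow_le` the
squared increments at level `k` sum to at most `q² b_k² M^(q-2)` times empirical sums `∑
|f(x_j)|^q`, which are themselves `O(Y + m)`. Here `b_k` is the net radius and `M = B N^(1/q)`
bounds the ball uniformly (entropy at `k = 0`). So the average is `O(q S √(M^(q-2) (Y + m)))`, where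
`S` bounds the sums `∑ √2^k b_k`. Once `m` dominates `q² S² M^(q-2)`, `E Y` can be absorbed on the
left, leaving `E Y ≤ m/5`, and some sample does at least as well as the mean.

The rate comes from `S = O(B max(D, √N))`, with `D` the quotient in the theorem
(`sum_sqrt_two_pow_mul_le`), and from `B² M^(q-2) = B^q N^(1-2/q)`. Homogeneity passes from the unit
ball to the whole subspace. -/

/-! ### Rademacher averages and the finite maximal inequality -/

/-- The sign attached to a Boolean. -/
def boolSign (b : Bool) : ℝ := if b then 1 else -1

/-- The average of a function over all sign patterns. -/
noncomputable def signAvg {m : ℕ} (F : (Fin m → Bool) → ℝ) : ℝ := (2 ^ m : ℝ)⁻¹ * ∑ e, F e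

lemma signAvg_mono {m : ℕ} {F G : (Fin m → Bool) → ℝ} (h : ∀ e, F e ≤ G e) :
    signAvg F ≤ signAvg G :=
  mul_le_mul_of_nonneg_left (Finset.sum_le_sum fun e _ => h e) (by positivity)

lemma signAvg_add {m : ℕ} (F G : (Fin m → Bool) → ℝ) :
    signAvg (fun e => F e + G e) = signAvg F + signAvg G := by
  simp only [signAvg, Finset.sum_add_distrib, mul_add]

lemma signAvg_const_mul {m : ℕ} (c : ℝ) (F : (Fin m → Bool) → ℝ) :
    signAvg (fun e => c * F e) = c * signAvg F := by
  simp only [signAvg, ← Finset.mul_sum]; ring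

lemma signAvg_const {m : ℕ} (c : ℝ) : signAvg (fun _ : Fin m → Bool => c) = c := by
  simp [signAvg]

lemma signAvg_finset_sum {m : ℕ} {ι : Type*} (s : Finset ι) (F : ι → (Fin m → Bool) → ℝ) :
    signAvg (fun e => ∑ i ∈ s, F i e) = ∑ i ∈ s, signAvg (F i) := by
  simp only [signAvg, ← Finset.mul_sum]
  rw [Finset.sum_comm]

/-- Independence of the signs factors the average into a product of `cosh (v j)`, and `cosh x ≤ exp
(x²/2)`. -/
lemma signAvg_exp_le {m : ℕ} (v : Fin m → ℝ) :
    signAvg (fun e => Real.exp (∑ j, boolSign (e j) * v j)) ≤ Real.exp ((∑ j, v j ^ 2) / 2) := by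
  have h1 : ∑ e : Fin m → Bool, Real.exp (∑ j, boolSign (e j) * v j)
      = ∏ j, (2 * Real.cosh (v j)) := by
    simp only [Real.exp_sum]
    rw [← Fintype.prod_sum (fun j b => Real.exp (boolSign b * v j))]
    refine Finset.prod_congr rfl fun j _ => ?_
    simp [boolSign, Real.cosh_eq]
    ring
  rw [signAvg, h1, Finset.prod_mul_distrib]
  simp only [Finset.prod_const, Finset.card_univ, Fintype.card_fin]
  rw [← mul_assoc, inv_mul_cancel₀ (by positivity), one_mul, Finset.sum_div, Real.exp_sum]
  exact Finset.prod_le_prod (fun j _ => (Real.cosh_pos _).le) fun j _ => Real.cosh_le_exp_half_sq _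

/-- Maximal inequality for finitely many Rademacher sums. -/
lemma signAvg_norm_le {m : ℕ} {ι : Type*} [Fintype ι] [Nonempty ι] (v : ι → Fin m → ℝ)
    {σ H : ℝ} (hσ : 0 < σ) (hH : Real.log (2 * Fintype.card ι) ≤ H)
    (hv : ∀ i, ∑ j, v i j ^ 2 ≤ σ ^ 2) :
    signAvg (fun e => ‖fun i => ∑ j, boolSign (e j) * v i j‖) ≤ σ * √(2 * H) := by
  have hcard : (1 : ℝ) ≤ Fintype.card ι := by exact_mod_cast Fintype.card_pos
  have hHpos : 0 < H := (Real.log_pos (by linarith)).trans_le hH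
  -- Chernoff parameter: `l²σ²/2 = H`, so each exponential moment is at most `exp H`, balancing the
  -- `log` of the number of terms.
  set l : ℝ := √(2 * H) / σ with hl
  have hlpos : 0 < l := by positivity
  have hl2 : l ^ 2 * σ ^ 2 = 2 * H := by
    rw [hl, div_pow, Real.sq_sqrt (by positivity)]; field_simp
  have hlσ : l * σ = √(2 * H) := by rw [hl]; field_simp
  set c : ℝ := 2 * H with hc
  -- The tangent line of `exp` at `c` replaces Jensen's inequality for the logarithm; both signs of
  -- each sum are included to reach absolute values.
  have key : ∀ e : Fin m → Bool,
      l * ‖fun i => ∑ j, boolSign (e j) * v i j‖ ≤ (c - 1) + Real.exp (-c) *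
        ∑ i, (Real.exp (∑ j, boolSign (e j) * (l * v i j)) +
          Real.exp (∑ j, boolSign (e j) * (-l * v i j))) := by
    intro e
    set w : ι → ℝ := fun i => ∑ j, boolSign (e j) * v i j with hw
    obtain ⟨i, hi⟩ : ∃ i, ‖w‖ = ‖w i‖ := by
      obtain ⟨i, _, hi⟩ := Finset.exists_mem_eq_sup Finset.univ Finset.univ_nonempty
        (fun i => ‖w i‖₊)
      refine ⟨i, ?_⟩
      rw [Pi.norm_def, hi, coe_nnnorm]
    have e1 : ∀ (i : ι) (t : ℝ), ∑ j, boolSign (e j) * (t * v i j) = t * w i := by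
      intro i t
      rw [hw, Finset.mul_sum]
      exact Finset.sum_congr rfl fun j _ => by ring
    have h1 : Real.exp (l * ‖w‖) ≤ ∑ i, (Real.exp (∑ j, boolSign (e j) * (l * v i j)) +
          Real.exp (∑ j, boolSign (e j) * (-l * v i j))) := by
      refine le_trans ?_ (Finset.single_le_sum (f := fun i =>
        (Real.exp (∑ j, boolSign (e j) * (l * v i j)) +
          Real.exp (∑ j, boolSign (e j) * (-l * v i j)))) (fun _ _ => by positivity)
        (Finset.mem_univ i))
      simp only [e1]
      rw [hi, Real.norm_eq_abs]
      rcases abs_cases (w i) with h | h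
      · rw [h.1]; have := Real.exp_pos (-l * w i); linarith
      · rw [h.1, mul_neg, ← neg_mul]; have := Real.exp_pos (l * w i); linarith
    have h2 := Real.add_one_le_exp (l * ‖w‖ - c)
    rw [sub_eq_neg_add, Real.exp_add] at h2
    have h3 := mul_le_mul_of_nonneg_left h1 (Real.exp_pos (-c)).le
    linarith
  have h4 := signAvg_mono key
  rw [signAvg_const_mul, signAvg_add, signAvg_const, signAvg_const_mul, signAvg_finset_sum] at h4
  have h5 : ∀ i : ι, signAvg (fun e => Real.exp (∑ j, boolSign (e j) * (l * v i j)) +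
      Real.exp (∑ j, boolSign (e j) * (-l * v i j))) ≤ 2 * Real.exp H := by
    intro i
    have aux : ∀ t : ℝ, t ^ 2 = l ^ 2 →
        signAvg (fun e => Real.exp (∑ j, boolSign (e j) * (t * v i j))) ≤ Real.exp H := by
      intro t ht
      refine (signAvg_exp_le (fun j => t * v i j)).trans (Real.exp_le_exp.2 ?_)
      simp only [mul_pow, ← Finset.mul_sum, ht]
      have := mul_le_mul_of_nonneg_left (hv i) (sq_nonneg l)
      linarith
    rw [signAvg_add]
    linarith [aux l rfl, aux (-l) (by ring)]
  have h6 : ∑ i : ι, signAvg (fun e => Real.exp (∑ j, boolSign (e j) * (l * v i j)) +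
      Real.exp (∑ j, boolSign (e j) * (-l * v i j))) ≤ Real.exp c := by
    refine (Finset.sum_le_sum fun i _ => h5 i).trans ?_
    rw [Finset.sum_const, nsmul_eq_mul, Finset.card_univ, hc, two_mul H, Real.exp_add]
    have : 2 * (Fintype.card ι : ℝ) ≤ Real.exp H := by
      rw [← Real.log_le_iff_le_exp (by positivity)]; exact hH
    nlinarith [Real.exp_pos H]
  have h7 : l * signAvg (fun e => ‖fun i => ∑ j, boolSign (e j) * v i j‖) ≤ c := by
    have := mul_le_mul_of_nonneg_left h6 (Real.exp_pos (-c)).le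
    rw [← Real.exp_add, neg_add_cancel, Real.exp_zero] at this
    linarith
  have h8 : c = l * (σ * √(2 * H)) := by
    rw [← mul_assoc, hlσ, Real.mul_self_sqrt (by positivity)]
  rw [h8] at h7
  exact le_of_mul_le_mul_left h7 hlpos

/-! ### Chaining -/

lemma coverSize_pos (k : ℕ) : 0 < coverSize k := by
  unfold coverSize; split_ifs <;> positivity

lemma sqrt_log_coverSize_le (k : ℕ) :
    ∃ H : ℝ, Real.log (2 * coverSize k) ≤ H ∧ √(2 * H) ≤ 2 * √2 ^ k := by
  refine ⟨2 * 2 ^ k * Real.log 2, ?_, ?_⟩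
  · have h : (2 * coverSize k : ℝ) ≤ 2 ^ (2 * 2 ^ k) := by
      have : 2 * coverSize k ≤ 2 ^ (2 * 2 ^ k) := by
        unfold coverSize
        split_ifs with h
        · simp [h]
        · rw [← pow_succ']
          exact Nat.pow_le_pow_right (by norm_num) (by have := Nat.one_le_two_pow (n := k); omega)
      exact_mod_cast this
    have h0 : (0 : ℝ) < 2 * coverSize k := by
      have : (0 : ℝ) < coverSize k := by exact_mod_cast coverSize_pos k
      linarith
    refine (Real.log_le_log h0 h).trans ?_
    rw [Real.log_pow]; push_cast; rfl
  · apply Real.sqrt_le_iff.2 ⟨by positivity, ?_⟩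
    rw [mul_pow, ← pow_mul, mul_comm k 2, pow_mul, Real.sq_sqrt (by norm_num)]
    have := Real.log_two_lt_d9
    have : (0:ℝ) < 2 ^ k := by positivity
    nlinarith

/-- Dudley's chaining bound for Rademacher sums, along nets of sizes `coverSize k` connected by
parent maps. -/
lemma signAvg_norm_chain_le {m : ℕ} (v : (k : ℕ) → Fin (coverSize k) → Fin m → ℝ)
    (p : (k : ℕ) → Fin (coverSize (k + 1)) → Fin (coverSize k)) (σ : ℕ → ℝ)
    (hσ : ∀ k, 0 < σ k) (h0 : ∀ i j, v 0 i j = 0)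
    (hv : ∀ k i, ∑ j, (v (k + 1) i j - v k (p k i) j) ^ 2 ≤ σ k ^ 2) (K : ℕ) :
    signAvg (fun e => ‖fun i => ∑ j, boolSign (e j) * v K i j‖) ≤
      ∑ k ∈ Finset.range K, σ k * (2 * √2 ^ (k + 1)) := by
  induction K with
  | zero =>
    simp only [h0, mul_zero, Finset.sum_const_zero, Finset.range_zero, Finset.sum_empty]
    rw [← Pi.zero_def, norm_zero, signAvg_const]
  | succ K ih =>
    rw [Finset.sum_range_succ]
    have : Nonempty (Fin (coverSize (K + 1))) := ⟨⟨0, coverSize_pos _⟩⟩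
    obtain ⟨H, hH1, hH2⟩ := sqrt_log_coverSize_le (K + 1)
    -- Each point has one parent, so level `K + 1` has only `coverSize (K + 1)` links.
    have h1 := signAvg_norm_le (fun i j => v (K + 1) i j - v K (p K i) j) (hσ K)
      (H := H) (by simpa using hH1) (hv K)
    have h2 : σ K * √(2 * H) ≤ σ K * (2 * √2 ^ (K + 1)) :=
      mul_le_mul_of_nonneg_left hH2 (hσ K).le
    refine le_trans ?_ (add_le_add ih (h1.trans h2))
    rw [← signAvg_add]
    refine signAvg_mono fun e => ?_
    refine (pi_norm_le_iff_of_nonneg (by positivity)).2 fun i => ?_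
    have e1 : ∑ j, boolSign (e j) * v (K + 1) i j = ∑ j, boolSign (e j) * v K (p K i) j +
        ∑ j, boolSign (e j) * (v (K + 1) i j - v K (p K i) j) := by
      rw [← Finset.sum_add_distrib]
      exact Finset.sum_congr rfl fun j _ => by ring
    rw [e1]
    refine (norm_add_le _ _).trans (add_le_add ?_ ?_)
    · exact norm_le_pi_norm (fun i => ∑ j, boolSign (e j) * v K i j) (p K i)
    · exact norm_le_pi_norm
        (fun i => ∑ j, boolSign (e j) * (v (K + 1) i j - v K (p K i) j)) i

/-! ### Increments of the `q`-th power -/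

/-- Bernoulli's inequality for `(b/a)^q`, taking `b ≤ a`. -/
lemma abs_rpow_sub_rpow_le {a b q : ℝ} (ha : 0 ≤ a) (hb : 0 ≤ b) (hq : 1 ≤ q) :
    |a ^ q - b ^ q| ≤ q * |a - b| * max a b ^ (q - 1) := by
  wlog hab : b ≤ a generalizing a b
  · have := this hb ha (le_of_not_ge hab)
    rwa [abs_sub_comm, abs_sub_comm b a, max_comm] at this
  rcases ha.eq_or_lt with rfl | hapos
  · obtain rfl : b = 0 := le_antisymm hab hb
    simp
  rw [max_eq_left hab, abs_of_nonneg (sub_nonneg.2 hab),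
    abs_of_nonneg (sub_nonneg.2 (Real.rpow_le_rpow hb hab (by linarith)))]
  have h := one_add_mul_self_le_rpow_one_add (s := b / a - 1) (p := q)
    (by have : 0 ≤ b / a := by positivity
        linarith) hq
  rw [add_sub_cancel, Real.div_rpow hb ha, le_div_iff₀ (by positivity)] at h
  have e : a ^ q = a * a ^ (q - 1) := by
    rw [← Real.rpow_one_add' ha (by linarith)]; congr 1; ring
  have e2 : (1 + q * (b / a - 1)) * a ^ q = a ^ q - q * (a - b) * a ^ (q - 1) := by
    rw [e]; field_simp; ring
  linarith

/-- Only `M^(q-2)` is spent on the uniform bound; the remaining `q`-th power is kept so that summing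
over sample points reproduces the empirical sums. -/
lemma sq_rpow_sub_rpow_le {a b q M : ℝ} (ha : 0 ≤ a) (hb : 0 ≤ b) (haM : a ≤ M) (hbM : b ≤ M)
    (hq : 2 ≤ q) :
    (a ^ q - b ^ q) ^ 2 ≤ q ^ 2 * (a - b) ^ 2 * M ^ (q - 2) * (a ^ q + b ^ q) := by
  have h := abs_rpow_sub_rpow_le ha hb (by linarith : 1 ≤ q)
  have h0 : 0 ≤ max a b := le_max_of_le_left ha
  have h1 : (max a b ^ (q - 1)) ^ 2 = max a b ^ (q - 2) * max a b ^ q := by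
    rw [← Real.rpow_natCast, ← Real.rpow_mul h0, ← Real.rpow_add_of_nonneg h0 (by linarith)
      (by linarith)]
    congr 1; push_cast; ring
  have h2 : max a b ^ (q - 2) ≤ M ^ (q - 2) :=
    Real.rpow_le_rpow h0 (max_le haM hbM) (by linarith)
  have h3 : max a b ^ q ≤ a ^ q + b ^ q := by
    have := Real.rpow_nonneg ha q
    have := Real.rpow_nonneg hb q
    rcases max_cases a b with h | h <;> rw [h.1] <;> linarith
  have h4 : 0 ≤ M ^ (q - 2) := Real.rpow_nonneg (ha.trans haM) _
  calc (a ^ q - b ^ q) ^ 2 = |a ^ q - b ^ q| ^ 2 := (sq_abs _).symm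
    _ ≤ (q * |a - b| * max a b ^ (q - 1)) ^ 2 := pow_le_pow_left₀ (abs_nonneg _) h 2
    _ = q ^ 2 * (a - b) ^ 2 * (max a b ^ (q - 2) * max a b ^ q) := by
      rw [mul_pow, mul_pow, sq_abs, h1]
    _ ≤ q ^ 2 * (a - b) ^ 2 * (M ^ (q - 2) * (a ^ q + b ^ q)) := by gcongr
    _ = _ := by ring

/-! ### Symmetrization -/

lemma Continuous.integrable_of_compactSpace {Z F : Type*} [TopologicalSpace Z] [CompactSpace Z]
    [SecondCountableTopology Z] [MeasurableSpace Z] [OpensMeasurableSpace Z]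
    [NormedAddCommGroup F] {μ : Measure Z} [IsFiniteMeasure μ] {φ : Z → F} (h : Continuous φ) :
    Integrable φ μ :=
  h.integrable_of_hasCompactSupport (HasCompactSupport.of_compactSpace _)

lemma measurePreserving_swap_coordinates {m : ℕ} {Ω : Type*} [MeasurableSpace Ω] (μ : Measure Ω)
    [IsProbabilityMeasure μ] (e : Fin m → Bool) :
    MeasurePreserving
      (fun z : (Fin m → Ω) × (Fin m → Ω) =>
        ((fun j => if e j then z.1 j else z.2 j, fun j => if e j then z.2 j else z.1 j) :
          (Fin m → Ω) × (Fin m → Ω)))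
      ((Measure.pi fun _ => μ).prod (Measure.pi fun _ => μ))
      ((Measure.pi fun _ => μ).prod (Measure.pi fun _ => μ)) := by
  have h1 := measurePreserving_arrowProdEquivProdArrow Ω Ω (Fin m) (fun _ => μ) (fun _ => μ)
  have h2 : ∀ j, MeasurePreserving (if e j then (id : Ω × Ω → Ω × Ω) else Prod.swap)
      (μ.prod μ) (μ.prod μ) := by
    intro j
    split_ifs
    · exact MeasurePreserving.id _
    · exact Measure.measurePreserving_swap
  have h3 := measurePreserving_pi (fun _ : Fin m => μ.prod μ) (fun _ : Fin m => μ.prod μ) h2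
  have h4 := (h1.comp h3).comp (h1.symm _)
  convert h4 using 1
  funext z
  refine Prod.ext ?_ ?_ <;> funext j <;>
    cases h : e j <;>
    simp [MeasurableEquiv.arrowProdEquivProdArrow, Equiv.arrowProdEquivProdArrow, h]

/-- Symmetrization of an empirical process. -/
lemma integral_norm_sum_sub_integral_le {m : ℕ} {Ω : Type*} [TopologicalSpace Ω] [CompactSpace Ω]
    [SecondCountableTopology Ω] [MeasurableSpace Ω] [BorelSpace Ω] (μ : Measure Ω)
    [IsProbabilityMeasure μ] {E : Type*} [NormedAddCommGroup E] [NormedSpace ℝ E]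
    [CompleteSpace E] {G : Ω → E} (hG : Continuous G) :
    ∫ x : Fin m → Ω, ‖∑ j, (G (x j) - ∫ w, G w ∂μ)‖ ∂(Measure.pi fun _ => μ) ≤
      2 * ∫ x : Fin m → Ω, signAvg (fun e => ‖∑ j, boolSign (e j) • G (x j)‖)
        ∂(Measure.pi fun _ => μ) := by
  set P : Measure (Fin m → Ω) := Measure.pi fun _ => μ with hP
  set S : (Fin m → Bool) → (Fin m → Ω) → E := fun e x => ∑ j, boolSign (e j) • G (x j) with hS
  have hSc : ∀ e, Continuous (S e) := fun e => by
    simp only [hS]; fun_prop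
  have hd : Integrable (fun z : (Fin m → Ω) × (Fin m → Ω) => ‖∑ j, (G (z.1 j) - G (z.2 j))‖)
      (P.prod P) := Continuous.integrable_of_compactSpace (by fun_prop)
  have hl : Integrable (fun x : Fin m → Ω => ‖∑ j, (G (x j) - ∫ w, G w ∂μ)‖) P :=
    Continuous.integrable_of_compactSpace (by fun_prop)
  have step1 : ∫ x, ‖∑ j, (G (x j) - ∫ w, G w ∂μ)‖ ∂P ≤
      ∫ z, ‖∑ j, (G (z.1 j) - G (z.2 j))‖ ∂(P.prod P) := by
    rw [integral_prod _ hd]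
    refine integral_mono hl hd.integral_prod_left ?_
    intro x
    -- The mean is an average over an independent second sample; Jensen then takes the norm inside.
    have e1 : ∑ j, (G (x j) - ∫ w, G w ∂μ) = ∫ y : Fin m → Ω, ∑ j, (G (x j) - G (y j)) ∂P := by
      have hi : ∀ j, Integrable (fun y : Fin m → Ω => G (y j)) P := fun j =>
        Continuous.integrable_of_compactSpace (by fun_prop)
      have hi' : ∀ j, Integrable (fun y : Fin m → Ω => G (x j) - G (y j)) P := fun j =>
        (integrable_const _).sub (hi j)
      rw [integral_finsetSum _ fun j _ => hi' j]
      refine Finset.sum_congr rfl fun j _ => ?_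
      rw [integral_sub (integrable_const _) (hi j), integral_const]
      have := (measurePreserving_eval (fun _ : Fin m => μ) j).map_eq
      have h2 : ∫ w, G w ∂μ = ∫ y : Fin m → Ω, G (y j) ∂P := by
        conv_lhs => rw [← this]
        rw [integral_map (measurable_pi_apply j).aemeasurable
          (by rw [this]; exact hG.integrable_of_compactSpace.aestronglyMeasurable)]
      simp [h2]
    change ‖_‖ ≤ _
    rw [e1]
    exact norm_integral_le_integral_norm _
  have step2 : ∀ e, ∫ z, ‖∑ j, (G (z.1 j) - G (z.2 j))‖ ∂(P.prod P) ≤ 2 * ∫ x, ‖S e x‖ ∂P := by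
    intro e
    have hmp := measurePreserving_swap_coordinates μ e
    rw [← hmp.map_eq, integral_map hmp.measurable.aemeasurable (by
      rw [hmp.map_eq]; exact hd.aestronglyMeasurable)]
    have e1 : ∀ z : (Fin m → Ω) × (Fin m → Ω),
        ‖∑ j, (G (if e j then z.1 j else z.2 j) - G (if e j then z.2 j else z.1 j))‖
          ≤ ‖S e z.1‖ + ‖S e z.2‖ := by
      intro z
      refine le_trans (le_of_eq ?_) (norm_sub_le (S e z.1) (S e z.2))
      congr 1
      simp only [hS]
      rw [← Finset.sum_sub_distrib]
      refine Finset.sum_congr rfl fun j _ => ?_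
      cases h : e j <;> simp [boolSign]
      abel
    have hc1 := hSc e
    have ia : Integrable (fun z : (Fin m → Ω) × (Fin m → Ω) => ‖S e z.1‖) (P.prod P) :=
      Continuous.integrable_of_compactSpace (by fun_prop)
    have ib : Integrable (fun z : (Fin m → Ω) × (Fin m → Ω) => ‖S e z.2‖) (P.prod P) :=
      Continuous.integrable_of_compactSpace (by fun_prop)
    refine (integral_mono (hmp.integrable_comp_of_integrable hd) (ia.add ib)
      fun z => e1 z).trans ?_
    simp only [Pi.add_apply]
    rw [integral_add ia ib, integral_fun_fst (fun x => ‖S e x‖),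
      integral_fun_snd (fun x => ‖S e x‖)]
    simp [two_mul]
  refine step1.trans ?_
  have h := signAvg_mono step2
  rw [signAvg_const, signAvg_const_mul] at h
  refine h.trans (le_of_eq ?_)
  simp only [signAvg]
  rw [integral_const_mul, integral_finsetSum _ fun e _ => Continuous.integrable_of_compactSpace (hSc e).norm]

/-! ### The entropy sum -/

/-- The entropy bound is summable against the Dudley weights. -/
lemma sum_sqrt_two_pow_mul_le {N : ℕ} (hN : 1 ≤ N) {q : ℝ} (hq : 2 < q) (K : ℕ) :
    ∑ k ∈ Finset.range K, √2 ^ k *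
      (if (k : ℝ) ≤ Real.logb 2 (N : ℝ) then ((N : ℝ) / 2 ^ k) ^ (1 / q)
            else (2 : ℝ) ^ (-((2 : ℝ) ^ k / (N : ℝ)))) ≤
    7 * max (((N : ℝ) ^ (1 / 2 : ℝ) - (N : ℝ) ^ (1 / q)) / (1 / 2 - 1 / q)) (√N) := by
  have hN1 : (1 : ℝ) ≤ N := by exact_mod_cast hN
  have hN0 : (0 : ℝ) < N := by linarith
  set a : ℝ := 1 / 2 - 1 / q with ha
  have hq0 : (0 : ℝ) < q := by linarith
  have hapos : 0 < a := by
    rw [ha, sub_pos]; exact one_div_lt_one_div_of_lt (by norm_num) hq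
  set D : ℝ := ((N : ℝ) ^ (1 / 2 : ℝ) - (N : ℝ) ^ (1 / q)) / a with hD
  set K0 : ℕ := Nat.log 2 N with hK0
  have hlow : 2 ^ K0 ≤ N := Nat.pow_log_le_self 2 (by omega)
  have hhigh : N < 2 ^ (K0 + 1) := Nat.lt_pow_succ_log_self (by norm_num) N
  have hs : ∀ k : ℕ, (2:ℝ) ^ k = √2 ^ k * √2 ^ k := fun k => by
    rw [← mul_pow, Real.mul_self_sqrt (by norm_num)]
  have hs0 : 0 < √2 := by positivity
  have hsl : (1.4 : ℝ) < √2 := Real.lt_sqrt_of_sq_lt (by norm_num)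
  have hcond : ∀ k : ℕ, (k : ℝ) ≤ Real.logb 2 (N : ℝ) ↔ k ≤ K0 := by
    intro k
    rw [Real.le_logb_iff_rpow_le (by norm_num) hN0, Real.rpow_natCast, hK0,
      Nat.le_log_iff_pow_le (by norm_num) (by omega)]
    exact_mod_cast Iff.rfl
  simp only [hcond]
  set t : ℕ → ℝ := fun k => √2 ^ k * (if k ≤ K0 then ((N : ℝ) / 2 ^ k) ^ (1 / q)
            else (2 : ℝ) ^ (-((2 : ℝ) ^ k / (N : ℝ)))) with ht
  have ht0 : ∀ k, 0 ≤ t k := by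
    intro k; simp only [ht]; split_ifs <;> positivity
  -- head
  have hhead : ∑ k ∈ Finset.range (K0 + 1), t k ≤ √N + 2 * D := by
    set ρ : ℝ := 2 ^ a with hρ
    -- Up to `log₂ N` the terms are geometric with ratio `ρ = 2^a`; this lower bound on `ρ - 1`
    -- produces the factor `1 / (1/2 - 1/q)`.
    have hρ1 : a / 2 ≤ ρ - 1 := by
      rw [hρ, Real.rpow_def_of_pos (by norm_num)]
      have := Real.add_one_le_exp (Real.log 2 * a)
      have := Real.log_two_gt_d9
      nlinarith
    have e1 : ∀ k ∈ Finset.range (K0 + 1), t k = (N : ℝ) ^ (1 / q) * ρ ^ k := by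
      intro k hk
      have hk' : k ≤ K0 := by simpa [Nat.lt_succ_iff] using hk
      simp only [ht, if_pos hk', hρ]
      rw [Real.div_rpow hN0.le (by positivity), ← Real.rpow_natCast (2 ^ a), ← Real.rpow_mul
        (by norm_num), Real.sqrt_eq_rpow, ← Real.rpow_natCast (2 ^ (1/2 : ℝ)), ← Real.rpow_mul
        (by norm_num), ← Real.rpow_natCast 2 k, ← Real.rpow_mul (by norm_num), mul_div_assoc',
        mul_comm, mul_div_assoc, ← Real.rpow_sub (by norm_num)]
      congr 2
      rw [ha]; ring
    have hρK : ρ ^ K0 ≤ (N : ℝ) ^ a := by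
      rw [hρ, ← Real.rpow_natCast, ← Real.rpow_mul (by norm_num), mul_comm,
        Real.rpow_mul (by norm_num), Real.rpow_natCast]
      exact Real.rpow_le_rpow (by positivity) (by exact_mod_cast hlow) hapos.le
    have hρ1' : 1 ≤ ρ ^ K0 := one_le_pow₀ (by linarith)
    have hgeom : ∑ k ∈ Finset.range K0, ρ ^ k ≤ ((N : ℝ) ^ a - 1) * 2 / a := by
      rw [geom_sum_eq (by linarith), div_le_div_iff₀ (by linarith) hapos]
      nlinarith
    have hNN : (N : ℝ) ^ (1 / q) * (N : ℝ) ^ a = √N := by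
      rw [← Real.rpow_add hN0, Real.sqrt_eq_rpow, ha]; congr 1; ring
    have hD' : D = (√N - (N : ℝ) ^ (1 / q)) / a := by rw [hD, Real.sqrt_eq_rpow]
    rw [Finset.sum_congr rfl e1, ← Finset.mul_sum, Finset.sum_range_succ]
    have hNq : 0 < (N : ℝ) ^ (1 / q) := by positivity
    calc (N : ℝ) ^ (1 / q) * (∑ k ∈ Finset.range K0, ρ ^ k + ρ ^ K0)
        ≤ (N : ℝ) ^ (1 / q) * (((N : ℝ) ^ a - 1) * 2 / a + (N : ℝ) ^ a) := by gcongr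
      _ = (N : ℝ) ^ (1 / q) * (N : ℝ) ^ a + 2 * (((N : ℝ) ^ (1 / q) * (N : ℝ) ^ a -
            (N : ℝ) ^ (1 / q)) / a) := by field_simp; ring
      _ = _ := by rw [hNN, hD']
  -- tail
  have hsN : √N ≤ √2 ^ (K0 + 1) := by
    rw [Real.sqrt_le_iff]
    refine ⟨by positivity, ?_⟩
    rw [sq, ← hs]
    exact_mod_cast hhigh.le
  -- Since `2^(-s) ≤ 1/s` for `s ≥ 1`, tail terms are at most `N / √2^k`; the subtracted remainder
  -- makes the induction close.
  have htail : ∀ n, ∑ k ∈ Finset.range n, t (K0 + 1 + k) ≤ 4 * √N - 4 * N / √2 ^ (K0 + 1 + n) := by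
    intro n
    have hNs : (N : ℝ) = √N * √N := (Real.mul_self_sqrt hN0.le).symm
    induction n with
    | zero =>
      simp only [Finset.range_zero, Finset.sum_empty, add_zero, sub_nonneg]
      rw [div_le_iff₀ (by positivity)]
      nlinarith [Real.sqrt_nonneg (N:ℝ)]
    | succ n ih =>
      rw [Finset.sum_range_succ]
      have h1 : t (K0 + 1 + n) ≤ N / √2 ^ (K0 + 1 + n) := by
        set k := K0 + 1 + n with hk
        have hk' : ¬ k ≤ K0 := by omega
        simp only [ht, if_neg hk']
        have h2 : (2 : ℝ) ^ (-((2 : ℝ) ^ k / (N : ℝ))) ≤ N / 2 ^ k := by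
          rw [Real.rpow_neg (by norm_num), ← inv_div ((2 : ℝ) ^ k) (N : ℝ)]
          refine inv_anti₀ (by positivity) ?_
          set s : ℝ := (2 : ℝ) ^ k / (N : ℝ) with hs'
          have hs1 : 1 ≤ s := by
            rw [hs', le_div_iff₀ hN0, one_mul]
            have : N ≤ 2 ^ k := hhigh.le.trans (Nat.pow_le_pow_right (by norm_num) (by omega))
            exact_mod_cast this
          have := one_add_mul_self_le_rpow_one_add (s := 1) (p := s) (by norm_num) hs1
          norm_num at this
          linarith
        calc √2 ^ k * (2 : ℝ) ^ (-((2 : ℝ) ^ k / (N : ℝ))) ≤ √2 ^ k * (N / 2 ^ k) := by gcongr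
          _ = N / √2 ^ k := by rw [hs]; field_simp
      have h2 : (N:ℝ) / √2 ^ (K0 + 1 + n) + 4 * N / √2 ^ (K0 + 1 + (n + 1)) ≤
          4 * N / √2 ^ (K0 + 1 + n) := by
        rw [← add_assoc (K0 + 1) n 1, pow_succ √2 (K0 + 1 + n)]
        have : (4:ℝ) * N / (√2 ^ (K0 + 1 + n) * √2) = (N / √2 ^ (K0 + 1 + n)) * (4 / √2) := by
          field_simp
        rw [this, mul_div_assoc]
        have h3 : 4 / √2 ≤ 3 := by rw [div_le_iff₀ hs0]; linarith
        have h4 : 0 ≤ (N:ℝ) / √2 ^ (K0 + 1 + n) := by positivity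
        nlinarith
      linarith
  have hsum : ∑ k ∈ Finset.range K, t k ≤ ∑ k ∈ Finset.range (K0 + 1 + K), t k :=
    Finset.sum_le_sum_of_subset_of_nonneg (Finset.range_mono (by omega)) fun k _ _ => ht0 k
  rw [Finset.sum_range_add] at hsum
  have h5 := htail K
  have h6 : 0 ≤ 4 * (N:ℝ) / √2 ^ (K0 + 1 + K) := by positivity
  have h7 := le_max_left D √N
  have h8 := le_max_right D √N
  linarith

/-! ### From nets to sample points -/

lemma exists_net_of_entropyNumber_le {F : Type*} [PseudoMetricSpace F] {A : Set F} {n : ℕ}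
    {b b' : ℝ} (h : entropyNumber A n ≤ ENNReal.ofReal b) (hb' : 0 < b') (hbb' : b < b') :
    ∃ f : Fin (coverSize n) → F, (∀ j, f j ∈ A) ∧ ∀ g ∈ A, ∃ j, dist g (f j) ≤ b' := by
  have h1 : entropyNumber A n < ENNReal.ofReal b' :=
    h.trans_lt ((ENNReal.ofReal_lt_ofReal_iff hb').2 hbb')
  simp only [entropyNumber, iInf_lt_iff] at h1
  obtain ⟨ε, ⟨f, hf, hcov⟩, hε⟩ := h1
  refine ⟨f, hf, fun g hg => ?_⟩
  obtain ⟨j, hj⟩ := Set.mem_iUnion.1 (hcov hg)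
  refine ⟨j, hj.le.trans ?_⟩
  rw [ENNReal.ofReal, ENNReal.coe_lt_coe] at hε
  exact (NNReal.coe_lt_coe.2 hε).le.trans (by rw [Real.coe_toNNReal _ hb'.le])

lemma exists_points_of_nets {Ω 𝕜 : Type*} [RCLike 𝕜] [TopologicalSpace Ω] [CompactSpace Ω]
    [SecondCountableTopology Ω] [MeasurableSpace Ω] [BorelSpace Ω] (μ : Measure Ω)
    [IsProbabilityMeasure μ] {q M S : ℝ} (hq : 2 < q) (hM : 0 < M) {A : Set C(Ω, 𝕜)}
    (hAM : ∀ f ∈ A, ∀ x, ‖f x‖ ≤ M) (hA1 : ∀ f ∈ A, ∫ x, ‖f x‖ ^ q ∂μ ≤ 1)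
    (b : ℕ → ℝ) (hb : ∀ k, 0 < b k) (T : (k : ℕ) → Fin (coverSize k) → C(Ω, 𝕜))
    (hTA : ∀ k i, T k i ∈ A) (hT : ∀ k, ∀ f ∈ A, ∃ i, dist f (T k i) ≤ b k)
    (hT0 : ∀ i, T 0 i = 0) (hS : ∀ K, ∑ k ∈ Finset.range K, √2 ^ k * b k ≤ S)
    {m : ℕ} (hm0 : 0 < m) (hm : 4096 * q ^ 2 * S ^ 2 * M ^ (q - 2) ≤ m) :
    ∃ ξ : Fin m → Ω, ∀ f ∈ A, |∑ j, ‖f (ξ j)‖ ^ q - m * ∫ x, ‖f x‖ ^ q ∂μ| ≤ m / 2 := by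
  have hm0' : (0 : ℝ) < m := by exact_mod_cast hm0
  have hq0 : 0 < q := by linarith
  have hs2 : 1 < √2 := Real.lt_sqrt_of_sq_lt (by norm_num)
  have hcont : ∀ f : C(Ω, 𝕜), Continuous fun x => ‖f x‖ ^ q := fun f =>
    f.continuous.norm.rpow_const fun _ => Or.inr hq0.le
  have hdist : ∀ (f g : C(Ω, 𝕜)) (x : Ω), |‖f x‖ - ‖g x‖| ≤ dist f g := fun f g x =>
    (abs_norm_sub_norm_le _ _).trans (by
      rw [← dist_eq_norm]; exact ContinuousMap.dist_apply_le_dist x)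
  have hclose : ∀ f ∈ A, ∀ g ∈ A, ∀ x,
      |‖f x‖ ^ q - ‖g x‖ ^ q| ≤ dist f g * (q * M ^ (q - 1)) := by
    intro f hf g hg x
    refine (abs_rpow_sub_rpow_le (norm_nonneg _) (norm_nonneg _) (by linarith)).trans ?_
    have h1 : max ‖f x‖ ‖g x‖ ^ (q - 1) ≤ M ^ (q - 1) :=
      Real.rpow_le_rpow (le_max_of_le_left (norm_nonneg _)) (max_le (hAM f hf x) (hAM g hg x))
        (by linarith)
    calc q * |‖f x‖ - ‖g x‖| * max ‖f x‖ ‖g x‖ ^ (q - 1)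
        ≤ q * dist f g * M ^ (q - 1) := by
          gcongr
          exact hdist f g x
      _ = _ := by ring
  -- a sufficiently fine net
  obtain ⟨K, hK⟩ : ∃ K, b K * (q * M ^ (q - 1)) ≤ 1 / 8 := by
    obtain ⟨K, hK⟩ := pow_unbounded_of_one_lt (8 * (q * M ^ (q - 1)) * S) hs2
    refine ⟨K, ?_⟩
    -- Boundedness of the Dudley sums alone forces `b K → 0`.
    have h1 : √2 ^ K * b K ≤ S :=
      (Finset.single_le_sum (f := fun k => √2 ^ k * b k)
        (fun k _ => mul_nonneg (by positivity) (hb k).le)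
        (Finset.self_mem_range_succ K)).trans (hS (K + 1))
    have h2 : 0 < √2 ^ K := by positivity
    have h3 : 0 < q * M ^ (q - 1) := by positivity
    have h4 : 8 * (q * M ^ (q - 1)) * (√2 ^ K * b K) ≤ √2 ^ K :=
      (mul_le_mul_of_nonneg_left h1 (by positivity)).trans hK.le
    have h5 : √2 ^ K * (8 * (b K * (q * M ^ (q - 1)))) ≤ √2 ^ K * 1 := by linarith
    linarith [le_of_mul_le_mul_left h5 h2]
  have hnear : ∀ f ∈ A, ∃ i, ∀ x, |‖f x‖ ^ q - ‖T K i x‖ ^ q| ≤ 1 / 8 := by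
    intro f hf
    obtain ⟨i, hi⟩ := hT K f hf
    refine ⟨i, fun x => (hclose f hf _ (hTA K i) x).trans (le_trans ?_ hK)⟩
    gcongr
  -- The net is encoded as one map into a finite-dimensional sup-norm space, so no supremum over an
  -- infinite class has to be integrated.
  set G : Ω → Fin (coverSize K) → ℝ := fun w i => ‖T K i w‖ ^ q with hG
  have hGc : Continuous G := continuous_pi fun i => hcont _
  have hint : ∀ f : C(Ω, 𝕜), Integrable (fun x => ‖f x‖ ^ q) μ := fun f =>
    (hcont f).integrable_of_compactSpace
  set Y : (Fin m → Ω) → ℝ := fun x => ‖∑ j, (G (x j) - ∫ w, G w ∂μ)‖ with hY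
  have hYi : ∀ x i, |∑ j, ‖T K i (x j)‖ ^ q - m * ∫ w, ‖T K i w‖ ^ q ∂μ| ≤ Y x := by
    intro x i
    refine le_trans (le_of_eq ?_) (norm_le_pi_norm (∑ j, (G (x j) - ∫ w, G w ∂μ)) i)
    rw [Finset.sum_apply, Real.norm_eq_abs]
    simp only [Pi.sub_apply, Finset.sum_sub_distrib]
    rw [eval_integral fun i => hint (T K i)]
    simp [hG]
  have hYA : ∀ x, ∀ f ∈ A, ∑ j, ‖f (x j)‖ ^ q ≤ Y x + 2 * m := by
    intro x f hf
    obtain ⟨i, hi⟩ := hnear f hf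
    have h1 : ∑ j, ‖f (x j)‖ ^ q ≤ ∑ j, (‖T K i (x j)‖ ^ q + 1 / 8) :=
      Finset.sum_le_sum fun j _ => by linarith [(abs_le.1 (hi (x j))).2]
    rw [Finset.sum_add_distrib] at h1
    simp only [Finset.sum_const, Finset.card_univ, Fintype.card_fin, nsmul_eq_mul] at h1
    have h2 := (abs_le.1 (hYi x i)).2
    have h3 := mul_le_mul_of_nonneg_left (hA1 _ (hTA K i)) hm0'.le
    linarith
  -- conditional chaining bound
  have hchain : ∀ x : Fin m → Ω,
      signAvg (fun e => ‖∑ j, boolSign (e j) • G (x j)‖) ≤ (Y x + 3 * m) / 32 := by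
    intro x
    have hY0 : 0 ≤ Y x := norm_nonneg _
    -- `R` bounds every empirical sum over `A`, hence the increment variances at all levels: this is
    -- the self-bounding.
    set R : ℝ := Y x + 2 * m with hR
    have hRpos : 0 < R := by positivity
    have hMq : 0 < M ^ (q - 2) := by positivity
    choose p hp using fun (k : ℕ) (i : Fin (coverSize (k + 1))) => hT k _ (hTA (k + 1) i)
    have hc := signAvg_norm_chain_le (fun k i j => ‖T k i (x j)‖ ^ q) p
      (fun k => q * b k * √(2 * M ^ (q - 2) * R))
      (fun k => mul_pos (mul_pos hq0 (hb k)) (by positivity))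
      (fun i j => by simp [hT0, hq0.ne'])
      (fun k i => by
        rw [mul_pow, Real.sq_sqrt (by positivity)]
        have h1 : ∀ j, (‖T (k + 1) i (x j)‖ ^ q - ‖T k (p k i) (x j)‖ ^ q) ^ 2 ≤
            q ^ 2 * b k ^ 2 * M ^ (q - 2) *
              (‖T (k + 1) i (x j)‖ ^ q + ‖T k (p k i) (x j)‖ ^ q) := by
          intro j
          refine (sq_rpow_sub_rpow_le (norm_nonneg _) (norm_nonneg _) (hAM _ (hTA _ _) _)
            (hAM _ (hTA _ _) _) hq.le).trans ?_
          have : (‖T (k + 1) i (x j)‖ - ‖T k (p k i) (x j)‖) ^ 2 ≤ b k ^ 2 :=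
            sq_le_sq' (by linarith [(abs_le.1 ((hdist _ _ (x j)).trans (hp k i))).1])
              (abs_le.1 ((hdist _ _ (x j)).trans (hp k i))).2
          gcongr
        refine (Finset.sum_le_sum fun j _ => h1 j).trans ?_
        rw [← Finset.mul_sum, Finset.sum_add_distrib]
        have h2 := hYA x _ (hTA (k + 1) i)
        have h3 := hYA x _ (hTA k (p k i))
        calc _ ≤ q ^ 2 * b k ^ 2 * M ^ (q - 2) * (R + R) := by gcongr
          _ = _ := by ring) K
    have e1 : ∀ e : Fin m → Bool, ‖fun i => ∑ j, boolSign (e j) * ‖T K i (x j)‖ ^ q‖ =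
        ‖∑ j, boolSign (e j) • G (x j)‖ := by
      intro e
      congr 1
      funext i
      simp [Finset.sum_apply, hG]
    simp only [e1] at hc
    refine hc.trans ?_
    have e2 : ∑ k ∈ Finset.range K, q * b k * √(2 * M ^ (q - 2) * R) * (2 * √2 ^ (k + 1)) =
        4 * q * √(M ^ (q - 2) * R) * ∑ k ∈ Finset.range K, √2 ^ k * b k := by
      rw [Finset.mul_sum]
      refine Finset.sum_congr rfl fun k _ => ?_
      rw [mul_assoc 2, Real.sqrt_mul (by norm_num), pow_succ]
      have := Real.mul_self_sqrt (show (0:ℝ) ≤ 2 by norm_num)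
      linear_combination (2 * q * b k * √(M ^ (q - 2) * R) * √2 ^ k) * this
    rw [e2]
    have hS0 : 0 ≤ S := by simpa using hS 0
    have h1 : 4 * q * √(M ^ (q - 2) * R) * ∑ k ∈ Finset.range K, √2 ^ k * b k ≤
        4 * q * √(M ^ (q - 2) * R) * S := by gcongr; exact hS K
    refine h1.trans (abs_le_of_sq_le_sq' ?_ (by positivity)).2
    have h2 : (4 * q * √(M ^ (q - 2) * R) * S) ^ 2 =
        (4096 * q ^ 2 * S ^ 2 * M ^ (q - 2)) * R / 256 := by
      rw [mul_pow, mul_pow, Real.sq_sqrt (by positivity)]; ring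
    have h3 := mul_le_mul_of_nonneg_right hm hRpos.le
    rw [h2]
    -- `(Y + 3m)² - 4m(Y + 2m) = (Y + m)²`.
    nlinarith [sq_nonneg (Y x + m)]
  have hYc : Continuous Y := by simp only [hY]; fun_prop
  have hW := integral_norm_sum_sub_integral_le (m := m) μ hGc
  have hW2 : ∫ x : Fin m → Ω, signAvg (fun e => ‖∑ j, boolSign (e j) • G (x j)‖)
      ∂(Measure.pi fun _ => μ) ≤ ((∫ x, Y x ∂(Measure.pi fun _ => μ)) + 3 * m) / 32 := by
    refine (integral_mono (Continuous.integrable_of_compactSpace ?_) (Continuous.integrable_of_compactSpace (by fun_prop)) hchain).trans (le_of_eq ?_)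
    · simp only [signAvg]; fun_prop
    · rw [integral_div, integral_add (Continuous.integrable_of_compactSpace hYc) (integrable_const _)]
      simp
  obtain ⟨ξ, hξ⟩ := exists_le_integral (μ := Measure.pi fun _ : Fin m => μ)
    (Continuous.integrable_of_compactSpace hYc)
  refine ⟨ξ, fun f hf => ?_⟩
  -- `E Y ≤ (E Y + 3m)/16` rearranges to `E Y ≤ m/5`.
  have hYξ : Y ξ ≤ m / 5 := by
    refine hξ.trans ?_
    change ∫ x, Y x ∂_ ≤ _ at hW
    linarith
  obtain ⟨i, hi⟩ := hnear f hf
  have h1 : |∑ j, ‖f (ξ j)‖ ^ q - ∑ j, ‖T K i (ξ j)‖ ^ q| ≤ m * (1 / 8) := by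
    rw [← Finset.sum_sub_distrib]
    refine (Finset.abs_sum_le_sum_abs _ _).trans
      ((Finset.sum_le_sum fun j _ => hi (ξ j)).trans (le_of_eq ?_))
    simp
  have h2 : |∫ x, ‖f x‖ ^ q ∂μ - ∫ x, ‖T K i x‖ ^ q ∂μ| ≤ 1 / 8 := by
    rw [← integral_sub (hint _) (hint _)]
    have := norm_integral_le_of_norm_le_const (μ := μ) (C := 1 / 8)
      (Filter.Eventually.of_forall fun x => (Real.norm_eq_abs _).trans_le (hi x))
    simpa using this
  have h3 := hYi ξ i
  rw [abs_le] at *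
  -- `1/5 + 1/8 + 1/8 < 1/2`.
  constructor <;> nlinarith

/-! ### The discretization theorem -/

theorem theorem4p4 :
    ∃ c : ℝ, 0 < c ∧
      ∀ (𝕜 : Type) [RCLike 𝕜] (d : ℕ) (Ω : Set (EuclideanSpace ℝ (Fin d))) [CompactSpace Ω]
        (μ : Measure Ω) [IsProbabilityMeasure μ]
        (N : ℕ) (_ : 1 ≤ N)
        (X : Submodule 𝕜 C(Ω, 𝕜)) [FiniteDimensional 𝕜 X] (_ : Module.finrank 𝕜 X = N)
        (q : ℝ) (_ : 2 < q) (B : ℝ) (_ : 0 < B)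
        (_ : ∀ k : ℕ, entropyNumber (lqUnitBall μ q X) k ≤
          ENNReal.ofReal (B *
            if (k : ℝ) ≤ Real.logb 2 (N : ℝ) then ((N : ℝ) / 2 ^ k) ^ (1 / q)
            else (2 : ℝ) ^ (-((2 : ℝ) ^ k / (N : ℝ)))))
        (m : ℕ)
        (_ : c * q ^ 2 * B ^ q * (N : ℝ) ^ (1 - 2 / q) *
            max ((((N : ℝ) ^ (1 / 2 : ℝ) - (N : ℝ) ^ (1 / q)) / (1 / 2 - 1 / q)) ^ 2) (N : ℝ)
          ≤ (m : ℝ)),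
        ∃ ξ : Fin m → Ω, ∀ f ∈ X,
          1 / 2 * lqNorm μ q f ^ q ≤ 1 / (m : ℝ) * ∑ j, ‖f (ξ j)‖ ^ q ∧
          1 / (m : ℝ) * ∑ j, ‖f (ξ j)‖ ^ q ≤ 3 / 2 * lqNorm μ q f ^ q := by
  -- `802816 = 4096 · 14²`, where `14 = 2 · 7` combines doubled net radii with the entropy-sum
  -- constant.
  refine ⟨802816, by norm_num, ?_⟩
  intro 𝕜 _ d Ω _ μ _ N hN X _ _ q hq B hB hent m hm
  have hq0 : 0 < q := by linarith
  have hN1 : (1 : ℝ) ≤ N := by exact_mod_cast hN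
  have hN0 : (0 : ℝ) < N := by linarith
  set M : ℝ := B * (N : ℝ) ^ (1 / q) with hMdef
  have hM : 0 < M := by positivity
  set D : ℝ := ((N : ℝ) ^ (1 / 2 : ℝ) - (N : ℝ) ^ (1 / q)) / (1 / 2 - 1 / q) with hD
  set t : ℕ → ℝ := fun k => if (k : ℝ) ≤ Real.logb 2 (N : ℝ) then ((N : ℝ) / 2 ^ k) ^ (1 / q)
            else (2 : ℝ) ^ (-((2 : ℝ) ^ k / (N : ℝ))) with ht
  have htpos : ∀ k, 0 < t k := by intro k; simp only [ht]; split_ifs <;> positivity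
  have ht0 : t 0 = (N : ℝ) ^ (1 / q) := by
    simp only [ht]
    rw [if_pos (by simpa using Real.logb_nonneg (by norm_num) hN1)]
    simp
  have hlq : ∀ f : C(Ω, 𝕜), lqNorm μ q f ^ q = ∫ x, ‖f x‖ ^ q ∂μ := by
    intro f
    rw [lqNorm, ← Real.rpow_mul (integral_nonneg fun x => by positivity),
      one_div_mul_cancel hq0.ne', Real.rpow_one]
  have hball : ∀ f : C(Ω, 𝕜), f ∈ lqUnitBall μ q X ↔ f ∈ X ∧ ∫ x, ‖f x‖ ^ q ∂μ ≤ 1 := by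
    intro f
    have h0 : 0 ≤ lqNorm μ q f := Real.rpow_nonneg (integral_nonneg fun x => by positivity) _
    rw [← hlq, ← Real.one_rpow q, Real.rpow_le_rpow_iff h0 zero_le_one hq0]
    rfl
  -- The single ball at level `0` contains both `f` and `-f`, so `‖2f‖` is at most its diameter
  -- bound, wherever its centre lies.
  have hnorm : ∀ f ∈ lqUnitBall μ q X, ‖f‖ ≤ M := by
    intro f hf
    refine le_of_forall_gt_imp_ge_of_dense fun ε hε => ?_
    obtain ⟨T, -, hT⟩ := exists_net_of_entropyNumber_le (hent 0) (hM.trans hε)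
      (by change B * t 0 < ε; rw [ht0]; exact hε)
    have hneg : -f ∈ lqUnitBall μ q X := by
      rw [hball] at hf ⊢
      exact ⟨X.neg_mem hf.1, by simpa using hf.2⟩
    have : Subsingleton (Fin (coverSize 0)) := by
      simp only [coverSize, if_true]; infer_instance
    obtain ⟨i, hi⟩ := hT f hf
    obtain ⟨j, hj⟩ := hT _ hneg
    obtain rfl := Subsingleton.elim i j
    have h1 := dist_triangle_right f (-f) (T i)
    rw [dist_eq_norm, sub_neg_eq_add, ← two_smul ℝ f, norm_smul] at h1
    norm_num at h1
    linarith
  have h0mem : (0 : C(Ω, 𝕜)) ∈ lqUnitBall μ q X := by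
    rw [hball]
    exact ⟨X.zero_mem, by simp [Real.zero_rpow hq0.ne']⟩
  -- Doubling the radius gives room above the infimum; at level `0` the centre is replaced by `0`,
  -- where the chain must start.
  have hnets : ∀ k, ∃ T : Fin (coverSize k) → C(Ω, 𝕜), (∀ i, T i ∈ lqUnitBall μ q X) ∧
      (∀ f ∈ lqUnitBall μ q X, ∃ i, dist f (T i) ≤ 2 * B * t k) ∧ (k = 0 → ∀ i, T i = 0) := by
    intro k
    rcases Nat.eq_zero_or_pos k with rfl | hk
    · refine ⟨fun _ => 0, fun _ => h0mem, fun f hf => ⟨⟨0, coverSize_pos 0⟩, ?_⟩, fun _ _ => rfl⟩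
      rw [dist_zero_right, ht0, mul_assoc]
      linarith [hnorm f hf]
    · have hBt := mul_pos hB (htpos k)
      obtain ⟨T, h1, h2⟩ := exists_net_of_entropyNumber_le (hent k) (b' := 2 * B * t k)
        (by linarith) (by change B * t k < _; linarith)
      exact ⟨T, h1, h2, fun h => absurd h hk.ne'⟩
  choose T hTA hT hT0 using hnets
  have hS : ∀ K, ∑ k ∈ Finset.range K, √2 ^ k * (2 * B * t k) ≤ 14 * B * max D √N := by
    intro K
    have h1 := mul_le_mul_of_nonneg_left (sum_sqrt_two_pow_mul_le hN hq K)
      (show 0 ≤ 2 * B by positivity)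
    rw [Finset.mul_sum] at h1
    refine (le_of_eq (Finset.sum_congr rfl fun k _ => ?_)).trans (h1.trans (le_of_eq ?_))
    · simp only [ht]; ring
    · rw [← hD]; ring
  have hmax : max D √N ^ 2 ≤ max (D ^ 2) (N : ℝ) := by
    rcases max_cases D √N with h | h <;> rw [h.1]
    · exact le_max_left _ _
    · rw [Real.sq_sqrt hN0.le]; exact le_max_right _ _
  have hMq : B ^ 2 * M ^ (q - 2) = B ^ q * (N : ℝ) ^ (1 - 2 / q) := by
    rw [hMdef, Real.mul_rpow hB.le (by positivity), ← Real.rpow_mul hN0.le, ← mul_assoc,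
      ← Real.rpow_natCast, ← Real.rpow_add hB]
    congr 2
    · push_cast; ring
    · field_simp
  have hm0' : (0 : ℝ) < m := by
    refine lt_of_lt_of_le ?_ hm
    have : 0 < max (D ^ 2) (N : ℝ) := hN0.trans_le (le_max_right _ _)
    positivity
  have hm0 : 0 < m := by exact_mod_cast hm0'
  have hm' : 4096 * q ^ 2 * (14 * B * max D √N) ^ 2 * M ^ (q - 2) ≤ m := by
    have h2 : 0 ≤ 802816 * q ^ 2 * (B ^ 2 * M ^ (q - 2)) := by positivity
    have h3 := mul_le_mul_of_nonneg_left hmax h2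
    rw [hMq] at h3
    rw [← mul_assoc] at h3
    refine le_trans (le_of_eq ?_) (h3.trans hm)
    linear_combination (802816 * q ^ 2 * max D √N ^ 2) * hMq
  obtain ⟨ξ, hξ⟩ : ∃ ξ : Fin m → Ω, ∀ f ∈ lqUnitBall μ q X,
      |∑ j, ‖f (ξ j)‖ ^ q - m * ∫ x, ‖f x‖ ^ q ∂μ| ≤ m / 2 := by
    have h1 : ∀ f ∈ lqUnitBall μ q X, ∀ x, ‖f x‖ ≤ M := fun f hf x =>
      (f.norm_coe_le_norm x).trans (hnorm f hf)
    have h2 : ∀ k, 0 < 2 * B * t k := fun k => mul_pos (by positivity) (htpos k)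
    have h3 := hT0 0 rfl
    exact exists_points_of_nets (S := 14 * B * max D √N) μ hq hM h1
      (fun f hf => ((hball f).1 hf).2) (fun k => 2 * B * t k) h2 T hTA hT h3 hS hm0 hm'
  refine ⟨ξ, fun f hf => ?_⟩
  rw [hlq]
  have hI0 : 0 ≤ ∫ x, ‖f x‖ ^ q ∂μ := integral_nonneg fun x => by positivity
  have hscale : ∀ (r : ℝ), 0 ≤ r → ∀ x, ‖((r : 𝕜) • f) x‖ ^ q = r ^ q * ‖f x‖ ^ q := by
    intro r hr x
    rw [ContinuousMap.smul_apply, norm_smul, RCLike.norm_ofReal, abs_of_nonneg hr,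
      Real.mul_rpow hr (norm_nonneg _)]
  rcases hI0.eq_or_lt with hI | hI
  · have hz : ∀ x, f x = 0 := by
      intro x
      by_contra hx
      have hx' : 0 < ‖f x‖ := norm_pos_iff.2 hx
      set r : ℝ := (M + 1) / ‖f x‖ with hr
      have hr0 : 0 ≤ r := by positivity
      have hmem : ((r : 𝕜) • f) ∈ lqUnitBall μ q X := by
        rw [hball]
        refine ⟨X.smul_mem _ hf, ?_⟩
        simp only [hscale r hr0]
        rw [integral_const_mul, ← hI]; simp
      have h1 := ((((r : 𝕜) • f)).norm_coe_le_norm x).trans (hnorm _ hmem)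
      rw [ContinuousMap.smul_apply, norm_smul, RCLike.norm_ofReal, abs_of_nonneg hr0, hr,
        div_mul_cancel₀ _ hx'.ne'] at h1
      linarith
    rw [← hI]
    simp [hz, Real.zero_rpow hq0.ne']
  · set I : ℝ := ∫ x, ‖f x‖ ^ q ∂μ with hIdef
    set r : ℝ := I⁻¹ ^ (1 / q) with hr
    have hr0 : 0 ≤ r := by positivity
    have hrq : r ^ q = I⁻¹ := by
      rw [hr, ← Real.rpow_mul (by positivity), one_div_mul_cancel hq0.ne', Real.rpow_one]
    have hint : ∫ x, ‖((r : 𝕜) • f) x‖ ^ q ∂μ = 1 := by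
      simp only [hscale r hr0]
      rw [integral_const_mul, hrq]
      exact inv_mul_cancel₀ hI.ne'
    have h1 := hξ ((r : 𝕜) • f) ((hball _).2 ⟨X.smul_mem _ hf, hint.le⟩)
    rw [hint] at h1
    simp only [hscale r hr0, hrq] at h1
    rw [← Finset.mul_sum, abs_le] at h1
    set s : ℝ := ∑ j, ‖f (ξ j)‖ ^ q with hs
    have h2 : s = I * (I⁻¹ * s) := by field_simp
    rw [one_div_mul_eq_div (m : ℝ) s, le_div_iff₀ hm0', div_le_iff₀ hm0']
    constructor <;> nlinarith
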